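/- Let $G$ be a simple graph (not necessarily finite) with vertex set $V$ and edge set $E$, and let $$\mathcal G(G)=\langle \sigma_u\ (u\in V)\mid \sigma_u\sigma_v=\sigma_v\sigma_u \text{ for } \{u,v\}\in E\rangle$$ be its graph group (right-angled Artin group). Let $\deg:\mathcal G(G)\to\mathbb Z$ be the homomorphism with $\deg(\sigma_u)=1$ for all $u\in V$. Let $\mathcal A=\mathbb Z[\mathcal G(G)]$ be the integral group ring and, for $n\in\mathbb Z$, let $\mathcal A_n\subseteq\mathcal A$ be the additive subgroup freely generated by the elements $g\in\mathcal G(G)$ with $\deg(g)\ge n$. The subgroups $\mathcal A_n$ form a decreasing filtration with $\mathcal A_p\mathcal A_q\subseteq\mathcal A_{p+q}$ and $1\in\mathcal A_0$. Let $\tilde{\mathcal A}$ be the completion of the ring $\mathcal A$ for the topology in which the $\mathcal A_n$ form a basis of neighbourhoods of $0$, and let $\mathcal U(\tilde{\mathcal A})$ be its group of units. For each $u\in V$ let $K_u\cong\mathbb Z\times\mathbb Z$ be a free abelian group with basis $\{\sigma_u,\tau_u\}$, and let $\tilde{\mathcal G}$ be the graph product of the family $(K_u)_{u\in V}$ along $G$,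 that is, the quotient of the free product of the groups $K_u$ by the relations $gh=hg$ for $g\in K_u$, $h\in K_v$, $\{u,v\}\in E$. Each $\sigma_u-\sigma_u^{-1}$ is a unit of $\tilde{\mathcal A}$, and $\tilde\eta:\tilde{\mathcal G}\to\mathcal U(\tilde{\mathcal A})$ denotes the group homomorphism determined by $$\tilde\eta(\sigma_u)=\sigma_u,\qquad \tilde\eta(\tau_u)=\sigma_u-\sigma_u^{-1}\qquad\text{for all } u\in V .$$ **Proposition.** The homomorphism $\tilde\eta$ is injective. -/

import Mathlib

open Filter Topology

universe u

noncomputable section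

/-- The graph group (right-angled Artin group) of a graph `G`: one generator `σ_u` for every
vertex `u`, subject to `σ_u σ_v = σ_v σ_u` for every edge `{u, v}`. -/
def GraphGroup {V : Type u} (G : SimpleGraph V) : Type u :=
  PresentedGroup {r : FreeGroup V | ∃ u v : V, G.Adj u v ∧ r = 
    FreeGroup.of u * FreeGroup.of v * (FreeGroup.of u)⁻¹ * (FreeGroup.of v)⁻¹}

namespace GraphGroup

variable {V : Type u} (G : SimpleGraph V)

instance : Group (GraphGroup G) :=
  inferInstanceAs (Group (PresentedGroup _))

/-- The standard generator `σ_u`. -/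
def gen (u : V) : GraphGroup G :=
  PresentedGroup.of u

theorem gen_comm {u v : V} (h : G.Adj u v) : Commute (gen G u) (gen G v) := by
  have h1 : PresentedGroup.mk {r : FreeGroup V | ∃ u v : V, G.Adj u v ∧ r =
      FreeGroup.of u * FreeGroup.of v * (FreeGroup.of u)⁻¹ * (FreeGroup.of v)⁻¹}
      (FreeGroup.of u * FreeGroup.of v * (FreeGroup.of u)⁻¹ * (FreeGroup.of v)⁻¹) = 1 :=
    PresentedGroup.one_of_mem ⟨u, v, h, rfl⟩
  simp only [map_mul, map_inv] at h1
  rw [mul_inv_eq_one, mul_inv_eq_iff_eq_mul] at h1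
  exact h1

/-- The degree homomorphism, sending every `σ_u` to `1 ∈ ℤ`
(written multiplicatively). -/
def degHom : GraphGroup G →* Multiplicative ℤ :=
  PresentedGroup.toGroup (f := fun _ : V => Multiplicative.ofAdd (1 : ℤ)) (by
    rintro r ⟨u, v, -, rfl⟩
    simp)

/-- The degree of an element of the graph group. -/
def deg (g : GraphGroup G) : ℤ :=
  Multiplicative.toAdd (degHom G g)

theorem deg_mul (g h : GraphGroup G) : deg G (g * h) = deg G g + deg G h := by
  simp [deg]

theorem deg_one : deg G 1 = 0 := by
  simp [deg]

theorem deg_gen_pow (u : V) (n : ℕ) : deg G (gen G u ^ n) = n := by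
  have h : degHom G (gen G u) = Multiplicative.ofAdd (1 : ℤ) := PresentedGroup.toGroup.of _
  simp [deg, h]

end GraphGroup

/-- The integral group algebra `A = ℤ[𝒢(G)]` of the graph group. -/
abbrev GraphAlgebra {V : Type u} (G : SimpleGraph V) : Type u :=
  MonoidAlgebra ℤ (GraphGroup G)

namespace GraphAlgebra

variable {V : Type u} (G : SimpleGraph V)

/-- The degree filtration: `A_n` consists of the integral combinations of elements of degree at
least `n`. -/
def filtration (n : ℤ) : AddSubgroup (GraphAlgebra G) where
  carrier := {x | ∀ g ∈ x.coeff.support, n ≤ GraphGroup.deg G g}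
  zero_mem' := by simp
  add_mem' := by
    classical
    intro x y hx hy g hg
    rw [MonoidAlgebra.coeff_add] at hg
    rcases Finset.mem_union.mp (Finsupp.support_add hg) with h | h
    · exact hx g h
    · exact hy g h
  neg_mem' := by
    intro x hx g hg
    rw [MonoidAlgebra.coeff_neg, Finsupp.support_neg] at hg
    exact hx g hg

theorem filtration_anti {m n : ℤ} (h : m ≤ n) : filtration G n ≤ filtration G m :=
  fun _ hx g hg => h.trans (hx g hg)

theorem filtration_mul {m n : ℤ} {x y : GraphAlgebra G} (hx : x ∈ filtration G m)
    (hy : y ∈ filtration G n) : x * y ∈ filtration G (m + n) := by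
  classical
  intro g hg
  obtain ⟨a, ha, b, hb, rfl⟩ := Finset.mem_mul.mp (MonoidAlgebra.support_coeff_mul_subset x y hg)
  rw [GraphGroup.deg_mul]
  exact add_le_add (hx a ha) (hy b hb)

theorem exists_mem_filtration (x : GraphAlgebra G) : ∃ n, x ∈ filtration G n := by
  classical
  obtain ⟨n, hn⟩ := (x.coeff.support.image (GraphGroup.deg G)).bddBelow
  exact ⟨n, fun g hg => hn (Finset.mem_coe.mpr (Finset.mem_image_of_mem _ hg))⟩

theorem of_mem_filtration {g : GraphGroup G} {n : ℤ} (h : n ≤ GraphGroup.deg G g) :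
    MonoidAlgebra.of ℤ (GraphGroup G) g ∈ filtration G n := by
  intro g' hg'
  have : g' = g := by simpa [MonoidAlgebra.of_apply] using hg'
  exact this ▸ h

theorem filtration_basis : RingSubgroupsBasis (filtration G) where
  inter i j := ⟨max i j, le_inf (filtration_anti G (le_max_left _ _))
    (filtration_anti G (le_max_right _ _))⟩
  mul i := by
    refine ⟨max i 0, ?_⟩
    rintro _ ⟨x, hx, y, hy, rfl⟩
    refine filtration_anti G ?_ (filtration_mul G hx hy)
    omega
  leftMul x i := by
    obtain ⟨n, hn⟩ := exists_mem_filtration G x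
    refine ⟨i - n, fun y hy => ?_⟩
    exact filtration_anti G (by omega) (filtration_mul G hn hy)
  rightMul x i := by
    obtain ⟨n, hn⟩ := exists_mem_filtration G x
    refine ⟨i - n, fun y hy => ?_⟩
    exact filtration_anti G (by omega) (filtration_mul G hy hn)

/-- The topology on `A` for which the `A_n` are a basis of neighbourhoods of `0`. -/
instance : TopologicalSpace (GraphAlgebra G) :=
  (filtration_basis G).topology

instance : IsTopologicalRing (GraphAlgebra G) :=
  (filtration_basis G).toRingFilterBasis.isTopologicalRing

/-- The uniform structure of the additive topological group `A`. -/
instance : UniformSpace (GraphAlgebra G) :=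
  IsTopologicalAddGroup.rightUniformSpace (GraphAlgebra G)

instance : IsUniformAddGroup (GraphAlgebra G) :=
  isUniformAddGroup_of_addCommGroup

theorem hasBasis_nhds_zero :
    (𝓝 (0 : GraphAlgebra G)).HasBasis (fun _ => True) fun n => (filtration G n : Set _) :=
  (filtration_basis G).hasBasis_nhds_zero

end GraphAlgebra

/-- The completion `Ã` of `A` with respect to the degree filtration; it carries the ring structure
extending that of `A` by continuity. -/
abbrev GraphAlgebraCompletion {V : Type u} (G : SimpleGraph V) : Type u :=
  UniformSpace.Completion (GraphAlgebra G)

namespace GraphAlgebraCompletion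

variable {V : Type u} (G : SimpleGraph V)

/-- The image in `Ã` of an element of the graph group. -/
def ofGroup : GraphGroup G →* GraphAlgebraCompletion G :=
  (UniformSpace.Completion.coeRingHom : GraphAlgebra G →+* GraphAlgebraCompletion G).toMonoidHom.comp
    (MonoidAlgebra.of ℤ (GraphGroup G))

/-- The element `σ_u` of `Ã`, as a unit. -/
def sigma (u : V) : (GraphAlgebraCompletion G)ˣ :=
  (ofGroup G).toHomUnits (GraphGroup.gen G u)

theorem sigma_val (u : V) : (sigma G u : GraphAlgebraCompletion G) =
    ofGroup G (GraphGroup.gen G u) := rfl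

theorem tendsto_pow (u : V) :
    Tendsto (fun n : ℕ => (sigma G u : GraphAlgebraCompletion G) ^ n) atTop (𝓝 0) := by
  have h : Tendsto (fun n : ℕ => MonoidAlgebra.of ℤ (GraphGroup G) (GraphGroup.gen G u ^ n)) atTop
      (𝓝 0) := by
    refine (GraphAlgebra.hasBasis_nhds_zero G).tendsto_right_iff.mpr fun i _ => ?_
    filter_upwards [eventually_ge_atTop i.toNat] with n hn
    refine GraphAlgebra.of_mem_filtration G ?_
    rw [GraphGroup.deg_gen_pow]
    omega
  have h2 := ((UniformSpace.Completion.continuous_coe (GraphAlgebra G)).tendsto 0).comp h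
  rw [UniformSpace.Completion.coe_zero] at h2
  refine h2.congr fun n => ?_
  rw [sigma_val, ← map_pow]
  rfl

/-- The partial sums of the series `∑ σ_u ^ (2 n + 1)` converge in `Ã`. -/
theorem exists_tendsto_sum (u : V) : ∃ y : GraphAlgebraCompletion G,
    Tendsto (fun n : ℕ => ∑ i ∈ Finset.range n, (sigma G u : GraphAlgebraCompletion G) ^ (2 * i + 1))
      atTop (𝓝 y) := by
  set a := MonoidAlgebra.of ℤ (GraphGroup G) (GraphGroup.gen G u) with ha
  have hmem : ∀ i : ℤ, ∀ m n : ℕ, i ≤ m → m ≤ n →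
      ∑ i ∈ Finset.range n, a ^ (2 * i + 1) - ∑ i ∈ Finset.range m, a ^ (2 * i + 1) ∈
        GraphAlgebra.filtration G i := by
    intro i m n him hmn
    rw [← Finset.sum_Ico_eq_sub _ hmn]
    refine sum_mem fun k hk => ?_
    rw [ha, ← map_pow]
    refine GraphAlgebra.of_mem_filtration G ?_
    rw [GraphGroup.deg_gen_pow]
    have := (Finset.mem_Ico.mp hk).1
    push_cast
    omega
  have hc : CauchySeq (fun n : ℕ => ∑ i ∈ Finset.range n, a ^ (2 * i + 1)) := by
    rw [cauchySeq_iff_tendsto, uniformity_eq_comap_nhds_zero, tendsto_comap_iff]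
    refine (GraphAlgebra.hasBasis_nhds_zero G).tendsto_right_iff.mpr fun i _ => ?_
    filter_upwards [eventually_ge_atTop (i.toNat, i.toNat)] with p hp
    obtain ⟨h1, h2⟩ := Prod.le_def.mp hp
    simp only at h1 h2
    rcases le_total p.1 p.2 with h | h
    · exact hmem i _ _ (by omega) h
    · have := (GraphAlgebra.filtration G i).neg_mem (hmem i _ _ (by omega) h)
      rw [neg_sub] at this
      exact this
  have hc' := (UniformSpace.Completion.uniformContinuous_coe (GraphAlgebra G)).comp_cauchySeq hc
  obtain ⟨y, hy⟩ := cauchySeq_tendsto_of_complete hc'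
  refine ⟨y, hy.congr fun n => ?_⟩
  change UniformSpace.Completion.coeRingHom (∑ i ∈ Finset.range n, a ^ (2 * i + 1)) = _
  rw [map_sum]
  simp only [map_pow]
  rfl

theorem isUnit_sigma_sub (u : V) :
    IsUnit ((sigma G u : GraphAlgebraCompletion G) - ((sigma G u)⁻¹ : (GraphAlgebraCompletion G)ˣ)) := by
  set s := sigma G u with hs
  set t : GraphAlgebraCompletion G := (s : GraphAlgebraCompletion G) - (s⁻¹ : (GraphAlgebraCompletion G)ˣ)
    with ht
  obtain ⟨y, hy⟩ := exists_tendsto_sum G u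
  have hcomm : ∀ n : ℕ, Commute t (∑ i ∈ Finset.range n, (s : GraphAlgebraCompletion G) ^ (2 * i + 1)) := by
    intro n
    refine Commute.sum_right _ _ _ fun i _ => ?_
    refine Commute.pow_right ?_ _
    refine (Commute.refl _).sub_left ?_
    exact (Commute.refl (s : GraphAlgebraCompletion G)).units_inv_left
  have hsum : ∀ n : ℕ, t * (∑ i ∈ Finset.range n, (s : GraphAlgebraCompletion G) ^ (2 * i + 1)) =
      (s : GraphAlgebraCompletion G) ^ (2 * n) - 1 := by
    intro n
    induction n with
    | zero => simp
    | succ n ih =>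
      rw [Finset.sum_range_succ, mul_add, ih, ht, sub_mul, ← pow_succ', pow_succ' _ (2 * n),
        Units.inv_mul_cancel_left,
        show 2 * (n + 1) = 2 * n + 1 + 1 by ring]
      abel
  have hlim : Tendsto (fun n : ℕ => (s : GraphAlgebraCompletion G) ^ (2 * n) - 1) atTop (𝓝 (0 - 1)) := by
    refine Tendsto.sub_const ?_ 1
    exact (tendsto_pow G u).comp (tendsto_id.const_mul_atTop' (by norm_num))
  have h1 : t * y = 0 - 1 :=
    tendsto_nhds_unique ((hy.const_mul t).congr hsum) hlim
  have h2 : y * t = 0 - 1 :=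
    tendsto_nhds_unique ((hy.mul_const t).congr fun n => ((hcomm n).eq.symm.trans (hsum n))) hlim
  exact ⟨⟨t, -y, by rw [mul_neg, h1]; simp, by rw [neg_mul, h2]; simp⟩, rfl⟩

/-- The element `σ_u - σ_u⁻¹` of `Ã`, as a unit. -/
def tau (u : V) : (GraphAlgebraCompletion G)ˣ :=
  (isUnit_sigma_sub G u).unit

theorem tau_val (u : V) : (tau G u : GraphAlgebraCompletion G) =
    (sigma G u : GraphAlgebraCompletion G) - ((sigma G u)⁻¹ : (GraphAlgebraCompletion G)ˣ) := rfl

theorem commute_tau {u : V} {x : (GraphAlgebraCompletion G)ˣ} (h : Commute x (sigma G u)) :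
    Commute x (tau G u) := by
  refine Commute.units_of_val ?_
  rw [tau_val]
  exact h.units_val.sub_right h.inv_right.units_val

theorem commute_sigma_sigma {u v : V} (h : G.Adj u v) : Commute (sigma G u) (sigma G v) :=
  Commute.map (GraphGroup.gen_comm G h) (ofGroup G).toHomUnits

end GraphAlgebraCompletion

/-- The relations `g h = h g` in the free product, for `g ∈ K_u`, `h ∈ K_v` and `{u, v}` an edge. -/
inductive GraphProductRel {V : Type u} (K : V → Type*) [∀ u, Group (K u)] (G : SimpleGraph V) :
    Monoid.CoprodI K → Monoid.CoprodI K → Prop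
  | comm {u v : V} (huv : G.Adj u v) (g : K u) (h : K v) :
      GraphProductRel K G (Monoid.CoprodI.of g * Monoid.CoprodI.of h)
        (Monoid.CoprodI.of h * Monoid.CoprodI.of g)

/-- The graph product of a family of groups `K_u` along a graph `G`: the quotient of the free
product of the `K_u` by the relations making `K_u` and `K_v` commute for every edge `{u, v}`. -/
def GraphProduct {V : Type u} (K : V → Type*) [∀ u, Group (K u)] (G : SimpleGraph V) : Type _ :=
  (conGen (GraphProductRel K G)).Quotient

namespace GraphProduct

variable {V : Type u} (K : V → Type*) [∀ u, Group (K u)] (G : SimpleGraph V)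

instance : Group (GraphProduct K G) :=
  inferInstanceAs (Group (conGen (GraphProductRel K G)).Quotient)

/-- The canonical homomorphism `K_u → 𝒢({K_u}, G)`. -/
def of (u : V) : K u →* GraphProduct K G :=
  (conGen (GraphProductRel K G)).mk'.comp Monoid.CoprodI.of

variable {K G} in
/-- The universal property of the graph product. -/
def lift {N : Type*} [Group N] (f : ∀ u, K u →* N)
    (hf : ∀ u v, G.Adj u v → ∀ (g : K u) (h : K v), Commute (f u g) (f v h)) :
    GraphProduct K G →* N :=
  (conGen (GraphProductRel K G)).lift (Monoid.CoprodI.lift f) (Con.conGen_le.mpr (by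
    rintro _ _ ⟨huv, g, h⟩
    rw [Con.ker_rel, map_mul, map_mul, Monoid.CoprodI.lift_of, Monoid.CoprodI.lift_of]
    exact hf _ _ huv g h))

variable {K G} in
theorem lift_of {N : Type*} [Group N] (f : ∀ u, K u →* N)
    (hf : ∀ u v, G.Adj u v → ∀ (g : K u) (h : K v), Commute (f u g) (f v h)) (u : V) (g : K u) :
    lift f hf (of K G u g) = f u g :=
  Monoid.CoprodI.lift_of f g

end GraphProduct

/-- The group `G̃`: the graph product along `G` of copies of `ℤ × ℤ` (written multiplicatively),
the copy at `u` being free abelian on `σ_u = (1, 0)` and `τ_u = (0, 1)`. -/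
abbrev ExtendedGraphGroup {V : Type u} (G : SimpleGraph V) : Type u :=
  GraphProduct (fun _ : V => Multiplicative ℤ × Multiplicative ℤ) G

namespace ExtendedGraphGroup

variable {V : Type u} (G : SimpleGraph V)

/-- The generator `σ_u` of `G̃`. -/
def sigma (u : V) : ExtendedGraphGroup G :=
  GraphProduct.of (fun _ : V => Multiplicative ℤ × Multiplicative ℤ) G u
    (Multiplicative.ofAdd 1, 1)

/-- The generator `τ_u` of `G̃`. -/
def tau (u : V) : ExtendedGraphGroup G :=
  GraphProduct.of (fun _ : V => Multiplicative ℤ × Multiplicative ℤ) G u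
    (1, Multiplicative.ofAdd 1)

/-- The restriction of `η̃` to the vertex group `⟨σ_u, τ_u⟩`: it sends `σ_u ^ p τ_u ^ q` to
`σ_u ^ p (σ_u - σ_u⁻¹) ^ q`. -/
def etaVertex (u : V) :
    Multiplicative ℤ × Multiplicative ℤ →* (GraphAlgebraCompletion G)ˣ :=
  MonoidHom.noncommCoprod (zpowersHom _ (GraphAlgebraCompletion.sigma G u))
    (zpowersHom _ (GraphAlgebraCompletion.tau G u)) (fun _ _ =>
      ((GraphAlgebraCompletion.commute_tau G (Commute.refl _)).zpow_left _).zpow_right _)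

theorem etaVertex_apply (u : V) (x : Multiplicative ℤ × Multiplicative ℤ) :
    etaVertex G u x = GraphAlgebraCompletion.sigma G u ^ (Multiplicative.toAdd x.1) *
      GraphAlgebraCompletion.tau G u ^ (Multiplicative.toAdd x.2) := rfl

/-- The homomorphism `η̃` from `G̃` to the group of units of `Ã`. -/
def eta : ExtendedGraphGroup G →* (GraphAlgebraCompletion G)ˣ :=
  GraphProduct.lift (etaVertex G) (by
    intro u v huv x y
    have h1 := GraphAlgebraCompletion.commute_sigma_sigma G huv
    have h2 := GraphAlgebraCompletion.commute_tau G h1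
    have h3 := (GraphAlgebraCompletion.commute_tau G h1.symm).symm
    have h4 := GraphAlgebraCompletion.commute_tau G h3
    rw [etaVertex_apply, etaVertex_apply]
    exact Commute.mul_left
      (((h1.zpow_left _).zpow_right _).mul_right ((h2.zpow_left _).zpow_right _))
      (((h3.zpow_left _).zpow_right _).mul_right ((h4.zpow_left _).zpow_right _)))

end ExtendedGraphGroup

end

/-!
The homomorphism `η̃` is detected by finite-dimensional representations of `Ã` over the field
`ℚ((t))`, one for each reduced word.

Suppose that square-zero matrices `N_v` are given, commuting for adjacent vertices. Then
`σ_v ↦ t (1 + N_v)` defines a representation of the graph group; as an element `g` is sent to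
`t ^ deg g` times an integral matrix, it is continuous for the degree filtration and extends to `Ã`
(`GraphAlgebraCompletion.completionRep`). Because `N_v ^ 2 = 0`, it sends `η̃ (σ_v ^ p τ_v ^ q)` to a
nonzero scalar times `1 + c N_v` with `c = p + q (t + t⁻¹) / (t - t⁻¹)`, and `c` vanishes only for
`p = q = 0`, since `t - t⁻¹` and `t + t⁻¹` are linearly independent over `ℤ`
(`GraphAlgebraCompletion.exists_completionRep_etaVertex`).

A nontrivial element of the graph product is a product of nontrivial syllables at vertices
`w₁, …, wₙ` that form a reduced word (`GraphProduct.exists_reduced_prod_eq`). Its image under `η̃` is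
sent to a scalar times `∏ (1 + cᵢ N_{wᵢ})`, so it suffices to find matrices for which the top term
`c₁ ⋯ cₙ N_{w₁} ⋯ N_{wₙ}` has a nonzero entry in a place where `1` and all lower terms vanish. The
module spanned by the sets of positions of the word serves this purpose: `N_v` removes a position
with letter `v` that can be brought to the front (`SimpleGraph.peelMatrix`). These matrices have
square zero because the word is reduced, and the entry in question leads from the set of all
positions to the empty set (`SimpleGraph.smul_prod_one_add_smul_peelMatrix_ne_one`).
-/

/-! ### Words and peeling operators -/

namespace SimpleGraph

variable {V : Type u} (G : SimpleGraph V) {n : ℕ} (w : Fin n → V)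

/-- The word `w` is reduced along `G` when two equal letters are always separated by a letter which
is not adjacent to them, so that they cannot be brought together by exchanging neighbouring
letters that are adjacent in `G`. -/
def IsReducedWord : Prop :=
  ∀ i j, i < j → w i = w j → ∃ k, i < k ∧ k < j ∧ ¬ G.Adj (w i) (w k)

/-- Position `i` has to stay to the left of position `j` in all words obtained from `w` by
exchanging neighbouring letters that are adjacent in `G`. Only the generating relations of this
partial order are recorded. -/
def Precedes (i j : Fin n) : Prop :=
  i < j ∧ ¬ G.Adj (w i) (w j)

/-- The position `i`, carrying the letter `v`, can be peeled off from the left of the set `F` of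
positions: nothing in `F` has to stay to its left. The last condition asks that what has to stay
to its right is still there. -/
structure IsPeelable (v : V) (F : Finset (Fin n)) (i : Fin n) : Prop where
  mem : i ∈ F
  letter : w i = v
  notMem_of_precedes : ∀ j, G.Precedes w j i → j ∉ F
  mem_of_precedes : ∀ j, G.Precedes w i j → j ∈ F

variable {G w}

theorem IsPeelable.unique {v : V} {F : Finset (Fin n)} {i j : Fin n} (hi : G.IsPeelable w v F i)
    (hj : G.IsPeelable w v F j) : i = j := by
  have hirr : ¬ G.Adj v v := G.loopless.irrefl v
  rcases lt_trichotomy i j with h | h | h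
  · exact absurd hi.mem (hj.notMem_of_precedes i ⟨h, by rwa [hi.letter, hj.letter]⟩)
  · exact h
  · exact absurd hj.mem (hi.notMem_of_precedes j ⟨h, by rwa [hi.letter, hj.letter]⟩)

variable (G w)

open Classical in
/-- The partial map on sets of positions that removes the position peeled off by the letter `v`. -/
noncomputable def peel (v : V) (F : Finset (Fin n)) : Option (Finset (Fin n)) :=
  if h : ∃ i, G.IsPeelable w v F i then some (F.erase h.choose) else none

variable {G w}

theorem peel_eq_some_iff {v : V} {F F' : Finset (Fin n)} :
    G.peel w v F = some F' ↔ ∃ i, G.IsPeelable w v F i ∧ F' = F.erase i := by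
  unfold peel
  split_ifs with h
  · refine ⟨fun e => ⟨_, h.choose_spec, (Option.some_injective _ e).symm⟩, ?_⟩
    rintro ⟨i, hi, rfl⟩
    rw [hi.unique h.choose_spec]
  · simp only [false_iff]
    exact fun ⟨i, hi, _⟩ => h ⟨i, hi⟩

theorem card_of_peel_eq_some {v : V} {F F' : Finset (Fin n)} (h : G.peel w v F = some F') :
    F'.card + 1 = F.card := by
  obtain ⟨i, hi, rfl⟩ := peel_eq_some_iff.mp h
  exact Finset.card_erase_add_one hi.mem

/-- Peeling the same letter twice is impossible: between the two positions there would be a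
letter that has to be peeled off in between. -/
theorem IsReducedWord.peel_bind_self (hw : G.IsReducedWord w) (v : V) (F : Finset (Fin n)) :
    (G.peel w v F).bind (G.peel w v) = none := by
  rw [Option.eq_none_iff_forall_ne_some]
  intro F'' h
  obtain ⟨F', h1, h2⟩ := Option.bind_eq_some_iff.mp h
  obtain ⟨i, hi, rfl⟩ := peel_eq_some_iff.mp h1
  obtain ⟨j, hj, rfl⟩ := peel_eq_some_iff.mp h2
  have hirr : ¬ G.Adj v v := G.loopless.irrefl v
  rcases lt_trichotomy i j with hij | hij | hij
  · obtain ⟨k, hik, hkj, hk⟩ := hw i j hij (hi.letter.trans hj.letter.symm)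
    have hkF : k ∈ F := hi.mem_of_precedes k ⟨hik, hk⟩
    refine hj.notMem_of_precedes k ⟨hkj, ?_⟩ (Finset.mem_erase.mpr ⟨hik.ne', hkF⟩)
    rwa [G.adj_comm, hj.letter, ← hi.letter]
  · exact Finset.ne_of_mem_erase hj.mem hij.symm
  · exact hi.notMem_of_precedes j ⟨hij, by rwa [hi.letter, hj.letter]⟩
      (Finset.mem_of_mem_erase hj.mem)

theorem peel_bind_peel_of_adj {u v : V} (huv : G.Adj u v) {F F'' : Finset (Fin n)}
    (h : (G.peel w u F).bind (G.peel w v) = some F'') :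
    (G.peel w v F).bind (G.peel w u) = some F'' := by
  obtain ⟨F', h1, h2⟩ := Option.bind_eq_some_iff.mp h
  obtain ⟨i, hi, rfl⟩ := peel_eq_some_iff.mp h1
  obtain ⟨j, hj, rfl⟩ := peel_eq_some_iff.mp h2
  have hne : i ≠ j := (Finset.ne_of_mem_erase hj.mem).symm
  have hij : ¬ G.Precedes w i j := fun h => h.2 (by rwa [hi.letter, hj.letter])
  have hji : ¬ G.Precedes w j i := fun h => h.2 (by rw [hi.letter, hj.letter]; exact huv.symm)
  refine Option.bind_eq_some_iff.mpr ⟨F.erase j, peel_eq_some_iff.mpr ⟨j, ?_, rfl⟩,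
    peel_eq_some_iff.mpr ⟨i, ?_, Finset.erase_right_comm⟩⟩
  · refine ⟨Finset.mem_of_mem_erase hj.mem, hj.letter, fun k hk hkF => ?_,
      fun k hk => Finset.mem_of_mem_erase (hj.mem_of_precedes k hk)⟩
    refine hj.notMem_of_precedes k hk (Finset.mem_erase.mpr ⟨?_, hkF⟩)
    rintro rfl
    exact hij hk
  · refine ⟨Finset.mem_erase.mpr ⟨hne, hi.mem⟩, hi.letter,
      fun k hk hkF => hi.notMem_of_precedes k hk (Finset.mem_of_mem_erase hkF),
      fun k hk => Finset.mem_erase.mpr ⟨?_, hi.mem_of_precedes k hk⟩⟩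
    rintro rfl
    exact hij hk

/-- The final segment of positions from `i` on is turned by the letter `w i` into the next
shorter one. -/
theorem peel_Ici (i : Fin n) :
    G.peel w (w i) (Finset.Ici i) = some (Finset.Ioi i) := by
  refine peel_eq_some_iff.mpr ⟨i, ⟨by simp, rfl, fun j hj => ?_, fun j hj => ?_⟩, ?_⟩
  · simpa using hj.1
  · simpa using hj.1.le
  · rw [Finset.Ici_erase]

variable (G w) (R : Type*) [CommRing R]

open Classical in
/-- The matrix of the partial map `SimpleGraph.peel`, on the free module with the sets of
positions as basis. -/
noncomputable def peelMatrix (v : V) : Matrix (Finset (Fin n)) (Finset (Fin n)) R :=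
  Matrix.of fun F F' => if G.peel w v F = some F' then 1 else 0

variable {R}

theorem peelMatrix_mul_apply (v : V) (A : Matrix (Finset (Fin n)) (Finset (Fin n)) R)
    (F F'' : Finset (Fin n)) :
    (G.peelMatrix w R v * A) F F'' = (G.peel w v F).elim 0 fun F' => A F' F'' := by
  rw [Matrix.mul_apply]
  cases h : G.peel w v F <;> simp [peelMatrix, h]

open Classical in
theorem peelMatrix_mul_peelMatrix_apply (u v : V) (F F'' : Finset (Fin n)) :
    (G.peelMatrix w R u * G.peelMatrix w R v) F F'' =
      if (G.peel w u F).bind (G.peel w v) = some F'' then 1 else 0 := by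
  rw [peelMatrix_mul_apply]
  cases h : G.peel w u F <;> simp [peelMatrix]

variable {G w}

theorem IsReducedWord.peelMatrix_mul_self (hw : G.IsReducedWord w) (v : V) :
    G.peelMatrix w R v * G.peelMatrix w R v = 0 := by
  ext F F''
  rw [peelMatrix_mul_peelMatrix_apply, hw.peel_bind_self]
  simp

theorem commute_peelMatrix {u v : V} (huv : G.Adj u v) :
    Commute (G.peelMatrix w R u) (G.peelMatrix w R v) := by
  ext F F''
  rw [peelMatrix_mul_peelMatrix_apply, peelMatrix_mul_peelMatrix_apply]
  exact if_congr ⟨peel_bind_peel_of_adj huv, peel_bind_peel_of_adj huv.symm⟩ rfl rfl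

theorem map_peelMatrix {S : Type*} [CommRing S] (f : R →+* S) (v : V) :
    f.mapMatrix (G.peelMatrix w R v) = G.peelMatrix w S v := by
  ext F F'
  simp only [peelMatrix, RingHom.mapMatrix_apply, Matrix.map_apply, Matrix.of_apply, apply_ite f,
    map_one, map_zero]

/-- Multiplying out `∏ (1 + cᵢ N_{wᵢ})`, the entry from the full set of positions to the empty one
only receives the top term `c₁ ⋯ cₙ N_{w₁} ⋯ N_{wₙ}`: every factor `N` lowers the cardinality
by one, and all positions have to be removed. The same holds for the final segments of the
word, over which the proof inducts. -/
theorem prod_one_add_smul_peelMatrix_apply (c : Fin n → R) (k : ℕ) (hk : k ≤ n) :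
    (((List.ofFn fun i => 1 + c i • G.peelMatrix w R (w i)).drop k).prod
        (Finset.univ.filter fun i : Fin n => k ≤ i) ∅ =
      ((List.ofFn c).drop k).prod) ∧
    ∀ F : Finset (Fin n), n - k < F.card →
      ((List.ofFn fun i => 1 + c i • G.peelMatrix w R (w i)).drop k).prod F ∅ = 0 := by
  induction hk using Nat.decreasingInduction with
  | self =>
    rw [List.drop_of_length_le (by simp), List.drop_of_length_le (by simp)]
    have : (Finset.univ.filter fun i : Fin n => n ≤ i) = ∅ := by ext i; simp
    rw [this]
    refine ⟨by simp, fun F hF => ?_⟩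
    rw [List.prod_nil, Matrix.one_apply_ne]
    rintro rfl
    simp at hF
  | of_succ k hk ih =>
    obtain ⟨ih1, ih2⟩ := ih
    rw [List.drop_eq_getElem_cons (l := List.ofFn c) (by simpa using hk),
      List.drop_eq_getElem_cons (by simpa using hk),
      List.prod_cons, List.prod_cons, List.getElem_ofFn, List.getElem_ofFn, add_mul, one_mul,
      smul_mul_assoc]
    have hIci : (Finset.univ.filter fun i : Fin n => k ≤ i) = Finset.Ici (⟨k, hk⟩ : Fin n) := by
      ext i; simp [Fin.le_def]
    have hIoi : (Finset.univ.filter fun i : Fin n => k + 1 ≤ i) = Finset.Ioi (⟨k, hk⟩ : Fin n) := by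
      ext i; simp [Fin.lt_def]
    rw [hIoi] at ih1
    constructor
    · rw [Matrix.add_apply, Matrix.smul_apply, peelMatrix_mul_apply, hIci, peel_Ici,
        ih2 _ (by rw [Fin.card_Ici]; change n - (k + 1) < n - k; omega), Option.elim_some, ih1, zero_add, smul_eq_mul]
    · intro F hF
      rw [Matrix.add_apply, Matrix.smul_apply, peelMatrix_mul_apply, ih2 F (by omega), zero_add]
      cases h : G.peel w (w ⟨k, hk⟩) F with
      | none => simp
      | some F' =>
        have := card_of_peel_eq_some h
        rw [Option.elim_some, ih2 F' (by omega), smul_zero]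

theorem smul_prod_one_add_smul_peelMatrix_ne_one [IsDomain R] (hn : 0 < n) {a : R} (ha : a ≠ 0)
    {c : Fin n → R} (hc : ∀ i, c i ≠ 0) :
    a • (List.ofFn fun i => 1 + c i • G.peelMatrix w R (w i)).prod ≠ 1 := by
  intro h
  have htop := (prod_one_add_smul_peelMatrix_apply (G := G) (w := w) c 0 n.zero_le).1
  have hne : (Finset.univ.filter fun i : Fin n => 0 ≤ (i : ℕ)) ≠ ∅ :=
    Finset.Nonempty.ne_empty ⟨⟨0, hn⟩, by simp⟩
  have h' := congrFun (congrFun h (Finset.univ.filter fun i : Fin n => 0 ≤ (i : ℕ))) ∅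
  rw [List.drop_zero, List.drop_zero] at htop
  rw [Matrix.smul_apply, htop, Matrix.one_apply_ne hne, List.prod_ofFn] at h'
  exact smul_ne_zero ha (Finset.prod_ne_zero_iff.mpr fun i _ => hc i) h'

end SimpleGraph

/-! ### Reduced expressions in a graph product -/

namespace GraphProduct

variable {V : Type u} {K : V → Type*} [∀ u, Group (K u)] {G : SimpleGraph V}

theorem commute_of {u v : V} (h : G.Adj u v) (x : K u) (y : K v) :
    Commute (of K G u x) (of K G v y) :=
  (Con.eq _).mpr (ConGen.Rel.of _ _ (GraphProductRel.comm h x y))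

theorem exists_prod_eq (g : GraphProduct K G) :
    ∃ L : List (Σ u, K u), (L.map fun p => of K G p.1 p.2).prod = g := by
  obtain ⟨x, rfl⟩ := Con.mk'_surjective g
  induction x using Monoid.CoprodI.induction_on with
  | one => exact ⟨[], (map_one _).symm⟩
  | of u k => exact ⟨[⟨u, k⟩], by simp only [List.map_cons, List.map_nil, List.prod_cons, List.prod_nil, mul_one]; rfl⟩
  | mul x y hx hy =>
    obtain ⟨L, hL⟩ := hx
    obtain ⟨M, hM⟩ := hy
    exact ⟨L ++ M, by rw [List.map_append, List.prod_append, hL, hM]; exact (map_mul _ x y).symm⟩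

/-- Every element of a graph product is a product of nontrivial elements of the vertex groups in
which two syllables at the same vertex are separated by one at a vertex not adjacent to it: an
expression of minimal length has these properties. -/
theorem exists_reduced_prod_eq (g : GraphProduct K G) :
    ∃ L : List (Σ u, K u), (L.map fun p => of K G p.1 p.2).prod = g ∧ (∀ p ∈ L, p.2 ≠ 1) ∧
      ∀ A B C x y, L = A ++ x :: (B ++ y :: C) → x.1 = y.1 → ∃ b ∈ B, ¬ G.Adj x.1 b.1 := by
  classical
  have hex : ∃ n, ∃ L : List (Σ u, K u), (L.map fun p => of K G p.1 p.2).prod = g ∧ L.length = n :=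
    let ⟨L, hL⟩ := exists_prod_eq g; ⟨_, L, hL, rfl⟩
  obtain ⟨L, hL, hlen⟩ := Nat.find_spec hex
  have hmin : ∀ M : List (Σ u, K u), (M.map fun p => of K G p.1 p.2).prod = g →
      L.length ≤ M.length := fun M hM => hlen ▸ Nat.find_min' hex ⟨M, hM, rfl⟩
  refine ⟨L, hL, ?_, ?_⟩
  · rintro p hp h1
    obtain ⟨A, B, rfl⟩ := List.append_of_mem hp
    have := hmin (A ++ B) (by rw [← hL]; simp [h1])
    simp at this
  · rintro A B C ⟨u, x⟩ ⟨v, y⟩ rfl (rfl : u = v)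
    by_contra! hB
    have hcomm : Commute (of K G u x) (B.map fun p => of K G p.1 p.2).prod := by
      refine Commute.list_prod_right _ _ fun z hz => ?_
      obtain ⟨b, hb, rfl⟩ := List.mem_map.mp hz
      exact commute_of (hB b hb) _ _
    have := hmin (A ++ (B ++ ⟨u, x * y⟩ :: C)) (by
      rw [← hL]
      simp only [List.map_append, List.map_cons, List.prod_append, List.prod_cons, map_mul]
      congr 1
      simp only [← mul_assoc]
      rw [hcomm.eq])
    simp at this

/-- The separation property of `exists_reduced_prod_eq`, in terms of positions. -/
theorem isReducedWord_of_forall_append {ι : V → Type*} {L : List (Σ u, ι u)}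
    (hL : ∀ A B C x y, L = A ++ x :: (B ++ y :: C) → x.1 = y.1 → ∃ b ∈ B, ¬ G.Adj x.1 b.1) :
    G.IsReducedWord fun i : Fin L.length => (L.get i).1 := by
  intro i j hij hwij
  obtain ⟨b, hb, hadj⟩ := hL (L.take i) ((L.drop (i + 1)).take (j - (i + 1))) (L.drop (j + 1))
    (L.get i) (L.get j) (by
      have h1 : L.drop j = L.get j :: L.drop (j + 1) := List.drop_eq_getElem_cons j.2
      have h2 : L.drop i = L.get i :: L.drop (i + 1) := List.drop_eq_getElem_cons i.2
      have h3 : L.drop j = (L.drop (i + 1)).drop (j - (i + 1)) := by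
        rw [List.drop_drop, Nat.add_sub_cancel' hij]
      rw [← h1, h3, List.take_append_drop, ← h2, List.take_append_drop]) hwij
  obtain ⟨k, hk, rfl⟩ := List.mem_iff_getElem.mp hb
  simp only [List.length_take, List.length_drop, lt_min_iff] at hk
  refine ⟨⟨i + 1 + k, by omega⟩, Fin.lt_def.mpr (by simp only; omega),
    Fin.lt_def.mpr (by simp only; omega), ?_⟩
  simpa using hadj

end GraphProduct

noncomputable section

/-! ### Elements `a (1 + c N)` for a square-zero `N` -/

section SquareZero

variable {R S : Type*} [CommRing R] [Ring S] [Algebra R S]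

/-- For `N` with `N * N = 0`, the homomorphism `(a, c) ↦ a (1 + c N)` from the product of the units
and the additive group of `R`. -/
def squareZeroUnit (N : S) (hN : N * N = 0) : Rˣ × Multiplicative R →* Sˣ :=
  MonoidHom.toHomUnits
    { toFun := fun x => (x.1 : R) • (1 + x.2.toAdd • N)
      map_one' := by simp
      map_mul' := fun x y => by
        simp only [Prod.fst_mul, Prod.snd_mul, Units.val_mul, toAdd_mul, smul_mul_smul_comm,
          add_mul, mul_add, one_mul, mul_one, hN, smul_zero, add_zero, add_smul, add_assoc] }

theorem squareZeroUnit_val (N : S) (hN : N * N = 0) (a : Rˣ) (c : R) :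
    (squareZeroUnit N hN (a, Multiplicative.ofAdd c) : S) = (a : R) • (1 + c • N) := rfl

theorem exists_prod_map_smul_eq {ι : Type*} (a : ι → Rˣ) (B : ι → S) (L : List ι) :
    ∃ b : Rˣ, (L.map fun i => (a i : R) • B i).prod = (b : R) • (L.map B).prod := by
  induction L with
  | nil => exact ⟨1, by simp⟩
  | cons i L ih =>
    obtain ⟨b, hb⟩ := ih
    refine ⟨a i * b, ?_⟩
    rw [List.map_cons, List.prod_cons, hb, List.map_cons, List.prod_cons, smul_mul_smul_comm,
      Units.val_mul]

end SquareZero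

/-! ### The Laurent series field `ℚ((t))` -/

namespace LaurentSeries

open scoped LaurentSeries

/-- The variable `t` of `ℚ((t))`. -/
def t : ℚ⸨X⸩ := HahnSeries.single 1 1

theorem t_ne_zero : t ≠ 0 := by
  simp [t]

theorem t_zpow (d : ℤ) : t ^ d = HahnSeries.single d 1 := by
  rw [t, ← RatFunc.single_zpow]

theorem t_inv : t⁻¹ = HahnSeries.single (-1) 1 := by
  rw [← zpow_neg_one, t_zpow]

theorem coeff_t_zpow_mul_intCast (d m i : ℤ) (h : i ≠ d) : (t ^ d * (m : ℚ⸨X⸩)).coeff i = 0 := by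
  rw [t_zpow, mul_comm, ← zsmul_eq_mul, HahnSeries.coeff_smul, HahnSeries.coeff_single_of_ne h,
    smul_zero]

/-- `t - t⁻¹` and `t + t⁻¹` are linearly independent over `ℤ`: compare the coefficients of `t` and
`t⁻¹`. -/
theorem linear_combination_ne_zero {p q : ℤ} (h : p ≠ 0 ∨ q ≠ 0) :
    (p : ℚ⸨X⸩) * (t - t⁻¹) + q * (t + t⁻¹) ≠ 0 := by
  intro h0
  have h1 := congrArg (fun f : ℚ⸨X⸩ => f.coeff 1) h0
  have h2 := congrArg (fun f : ℚ⸨X⸩ => f.coeff (-1)) h0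
  simp only [t_inv, ← zsmul_eq_mul, HahnSeries.coeff_add, HahnSeries.coeff_smul,
    HahnSeries.coeff_sub, HahnSeries.coeff_zero] at h1 h2
  simp [t] at h1 h2
  norm_cast at h1 h2
  omega

theorem t_sub_inv_ne_zero : t - t⁻¹ ≠ 0 := by
  simpa using linear_combination_ne_zero (p := 1) (q := 0) (by simp)

/-- The unit `t`. -/
def tUnit : ℚ⸨X⸩ˣ := Units.mk0 t t_ne_zero

/-- The unit `t - t⁻¹`. -/
def tSubInvUnit : ℚ⸨X⸩ˣ := Units.mk0 (t - t⁻¹) t_sub_inv_ne_zero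

/-- Every neighbourhood of zero contains all Laurent series of sufficiently large order. -/
theorem exists_coeff_eq_zero_imp_mem {s : Set ℚ⸨X⸩} (hs : s ∈ 𝓝 (0 : ℚ⸨X⸩)) :
    ∃ d : ℤ, ∀ f : ℚ⸨X⸩, (∀ i < d, f.coeff i = 0) → f ∈ s := by
  obtain ⟨γ, hγ⟩ := Valued.mem_nhds_zero.mp hs
  set δ := MonoidWithZeroHom.ValueGroup₀.embedding γ.1 with hδ
  have hδ0 : δ ≠ 0 := (map_ne_zero _).mpr γ.ne_zero
  -- The neighbourhood is given by a strict inequality, hence the shift by one.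
  refine ⟨-(WithZero.log δ - 1), fun f hf => hγ ?_⟩
  refine (Valuation.restrict_lt_iff_lt_embedding _).mpr ?_
  refine ((LaurentSeries.valuation_le_iff_coeff_lt_eq_zero ℚ).mpr hf).trans_lt ?_
  rw [neg_neg, ← hδ, ← WithZero.lt_log_iff_exp_lt hδ0]
  omega

end LaurentSeries

/-! ### The representation of the completed group ring -/

namespace GraphAlgebraCompletion

open scoped LaurentSeries
open LaurentSeries

variable {V : Type u} {G : SimpleGraph V} {n : ℕ} {w : Fin n → V}

/-- The representation of the graph group by integral matrices with `σ_v ↦ 1 + N_v`. -/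
def intRep (hw : G.IsReducedWord w) :
    GraphGroup G →* (Matrix (Finset (Fin n)) (Finset (Fin n)) ℤ)ˣ :=
  PresentedGroup.toGroup
    (f := fun v => squareZeroUnit (R := ℤ) (G.peelMatrix w ℤ v) (hw.peelMatrix_mul_self v)
      (1, Multiplicative.ofAdd 1)) (by
    rintro r ⟨u, v, huv, rfl⟩
    simp only [map_mul, map_inv, FreeGroup.lift_apply_of]
    rw [mul_inv_eq_one, mul_inv_eq_iff_eq_mul, Units.ext_iff, Units.val_mul, Units.val_mul,
      squareZeroUnit_val, squareZeroUnit_val]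
    simp only [Units.val_one, one_smul]
    exact ((Commute.one_right _).add_right
      ((Commute.one_left _).add_left (SimpleGraph.commute_peelMatrix huv))).eq)

theorem intRep_gen (hw : G.IsReducedWord w) (v : V) :
    (intRep hw (GraphGroup.gen G v) : Matrix _ _ ℤ) = 1 + G.peelMatrix w ℤ v := by
  rw [intRep, GraphGroup.gen]
  erw [PresentedGroup.toGroup.of]
  rw [squareZeroUnit_val]
  simp

/-- The representation of the graph group over `ℚ((t))` with `σ_v ↦ t (1 + N_v)`; the power of `t`
records the degree. -/
def laurentRep (hw : G.IsReducedWord w) :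
    GraphGroup G →* Matrix (Finset (Fin n)) (Finset (Fin n)) ℚ⸨X⸩ where
  toFun g := t ^ GraphGroup.deg G g •
    (Int.castRingHom ℚ⸨X⸩).mapMatrix (intRep hw g : Matrix _ _ ℤ)
  map_one' := by simp [GraphGroup.deg_one]
  map_mul' g h := by
    rw [GraphGroup.deg_mul, zpow_add₀ t_ne_zero, map_mul, Units.val_mul, map_mul,
      smul_mul_smul_comm]

theorem laurentRep_apply (hw : G.IsReducedWord w) (g : GraphGroup G) :
    laurentRep hw g = t ^ GraphGroup.deg G g •
      (Int.castRingHom ℚ⸨X⸩).mapMatrix (intRep hw g : Matrix _ _ ℤ) := rfl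

theorem laurentRep_gen (hw : G.IsReducedWord w) (v : V) :
    laurentRep hw (GraphGroup.gen G v) = t • (1 + G.peelMatrix w ℚ⸨X⸩ v) := by
  have hdeg : GraphGroup.deg G (GraphGroup.gen G v) = 1 := by
    simpa using GraphGroup.deg_gen_pow G v 1
  have h1 : (Int.castRingHom ℚ⸨X⸩).mapMatrix
      (1 : Matrix (Finset (Fin n)) (Finset (Fin n)) ℤ) = 1 := map_one _
  rw [laurentRep_apply, hdeg, zpow_one, intRep_gen]
  rw [RingHom.map_add, h1, SimpleGraph.map_peelMatrix]

/-- The extension of `laurentRep` to the group ring. -/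
def algebraRep (hw : G.IsReducedWord w) :
    GraphAlgebra G →+* Matrix (Finset (Fin n)) (Finset (Fin n)) ℚ⸨X⸩ :=
  MonoidAlgebra.liftNCRingHom (Int.castRingHom _) (laurentRep hw) fun m _ => Int.cast_commute m _

theorem algebraRep_of (hw : G.IsReducedWord w) (g : GraphGroup G) :
    algebraRep hw (MonoidAlgebra.of ℤ _ g) = laurentRep hw g := by
  rw [MonoidAlgebra.of_apply, algebraRep, MonoidAlgebra.liftNCRingHom_single, map_one, one_mul]

theorem coeff_algebraRep_apply (hw : G.IsReducedWord w) {d : ℤ} {x : GraphAlgebra G}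
    (hx : x ∈ GraphAlgebra.filtration G d) (F F' : Finset (Fin n)) {i : ℤ} (hi : i < d) :
    (algebraRep hw x F F').coeff i = 0 := by
  have h : algebraRep hw x = x.coeff.sum fun g m => m • laurentRep hw g := by
    conv_lhs => rw [← MonoidAlgebra.sum_coeff_single x]
    rw [map_finsuppSum]
    refine Finsupp.sum_congr fun g _ => ?_
    rw [algebraRep, MonoidAlgebra.liftNCRingHom_single, zsmul_eq_mul]
    rfl
  rw [h, Finsupp.sum, Matrix.sum_apply, HahnSeries.coeff_sum]
  refine Finset.sum_eq_zero fun g hg => ?_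
  rw [Matrix.smul_apply, HahnSeries.coeff_smul]
  refine smul_eq_zero_of_right _ (coeff_t_zpow_mul_intCast (GraphGroup.deg G g) _ i ?_)
  exact (hi.trans_le (hx g hg)).ne

theorem continuous_algebraRep (hw : G.IsReducedWord w) : Continuous (algebraRep hw) := by
  refine continuous_of_continuousAt_zero (algebraRep hw) ?_
  rw [ContinuousAt, map_zero]
  refine tendsto_pi_nhds.mpr fun F => tendsto_pi_nhds.mpr fun F' => ?_
  intro s hs
  obtain ⟨d, hd⟩ := exists_coeff_eq_zero_imp_mem hs
  refine (GraphAlgebra.hasBasis_nhds_zero G).mem_iff.mpr ⟨d, trivial, fun x hx => ?_⟩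
  exact hd _ fun i hi => coeff_algebraRep_apply hw hx F F' hi

/-- The extension of `algebraRep` to the completion by continuity. -/
def completionRep (hw : G.IsReducedWord w) :
    GraphAlgebraCompletion G →+* Matrix (Finset (Fin n)) (Finset (Fin n)) ℚ⸨X⸩ :=
  UniformSpace.Completion.extensionHom (algebraRep hw) (continuous_algebraRep hw)

/-- The homomorphism `(a, c) ↦ a (1 + c N_v)`. -/
def vertexUnit (hw : G.IsReducedWord w) (v : V) :
    ℚ⸨X⸩ˣ × Multiplicative ℚ⸨X⸩ →* (Matrix (Finset (Fin n)) (Finset (Fin n)) ℚ⸨X⸩)ˣ :=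
  squareZeroUnit (G.peelMatrix w ℚ⸨X⸩ v) (hw.peelMatrix_mul_self v)

theorem map_completionRep_sigma (hw : G.IsReducedWord w) (v : V) :
    Units.map (completionRep hw).toMonoidHom (sigma G v) =
      vertexUnit hw v (tUnit, Multiplicative.ofAdd 1) := by
  ext1
  rw [vertexUnit, squareZeroUnit_val, one_smul]
  exact (UniformSpace.Completion.extensionHom_coe _ _ _).trans
    ((algebraRep_of hw _).trans (laurentRep_gen hw v))

/-- The image of `σ_v - σ_v⁻¹` is `t (1 + N) - t⁻¹ (1 - N) = (t - t⁻¹) + (t + t⁻¹) N`. -/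
theorem map_completionRep_tau (hw : G.IsReducedWord w) (v : V) :
    Units.map (completionRep hw).toMonoidHom (tau G v) =
      vertexUnit hw v (tSubInvUnit, Multiplicative.ofAdd ((t + t⁻¹) / (t - t⁻¹))) := by
  ext1
  have hs := map_completionRep_sigma hw v
  have hs' := congrArg Units.val (congrArg (·⁻¹) hs)
  simp only [← map_inv, Prod.inv_mk, ← ofAdd_neg] at hs'
  have hs := congrArg Units.val hs
  rw [vertexUnit, squareZeroUnit_val] at hs hs' ⊢
  change completionRep hw (tau G v) = _
  change completionRep hw (sigma G v) = _ at hs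
  change completionRep hw ((sigma G v)⁻¹ : (GraphAlgebraCompletion G)ˣ) = _ at hs'
  have h1 : ((tUnit⁻¹ : ℚ⸨X⸩ˣ) : ℚ⸨X⸩) = t⁻¹ := rfl
  have h2 : (tUnit : ℚ⸨X⸩) = t := rfl
  have h3 : (tSubInvUnit : ℚ⸨X⸩) = t - t⁻¹ := rfl
  rw [tau_val, map_sub, hs, hs', h1, h2, h3, smul_add, smul_add, smul_add, smul_smul, smul_smul,
    smul_smul, mul_div_cancel₀ _ t_sub_inv_ne_zero]
  simp only [mul_one, mul_neg, neg_smul, add_smul, sub_smul]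
  abel

/-- The image of `σ_v ^ p τ_v ^ q` is a scalar times `1 + c N_v` with
`c = p + q (t + t⁻¹) / (t - t⁻¹)`, and `c ≠ 0` unless `p = q = 0`. -/
theorem exists_completionRep_etaVertex (hw : G.IsReducedWord w) (v : V)
    (x : Multiplicative ℤ × Multiplicative ℤ) :
    ∃ (a : ℚ⸨X⸩ˣ) (c : ℚ⸨X⸩), (x ≠ 1 → c ≠ 0) ∧
      completionRep hw (ExtendedGraphGroup.etaVertex G v x) =
        (a : ℚ⸨X⸩) • (1 + c • G.peelMatrix w ℚ⸨X⸩ v) := by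
  set p := Multiplicative.toAdd x.1 with hp
  set q := Multiplicative.toAdd x.2 with hq
  refine ⟨tUnit ^ p * tSubInvUnit ^ q, p + q * ((t + t⁻¹) / (t - t⁻¹)), fun hx h0 => ?_, ?_⟩
  · refine linear_combination_ne_zero (p := p) (q := q) ?_ ?_
    · by_contra! h
      exact hx (Prod.ext (toAdd_eq_zero.mp h.1) (toAdd_eq_zero.mp h.2))
    · have := t_sub_inv_ne_zero
      rw [← mul_div_assoc, add_div' _ _ _ this, div_eq_zero_iff, or_iff_left this] at h0
      exact h0
  · have h : Units.map (completionRep hw).toMonoidHom (ExtendedGraphGroup.etaVertex G v x) =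
        vertexUnit hw v (tUnit ^ p * tSubInvUnit ^ q,
          Multiplicative.ofAdd (p + q * ((t + t⁻¹) / (t - t⁻¹)))) := by
      rw [ExtendedGraphGroup.etaVertex_apply, map_mul, map_zpow, map_zpow,
        map_completionRep_sigma, map_completionRep_tau, ← map_zpow, ← map_zpow, ← map_mul]
      congr 1
      rw [Prod.pow_mk, Prod.pow_mk, Prod.mk_mul_mk, ← ofAdd_zsmul, ← ofAdd_zsmul, ← ofAdd_add,
        zsmul_one, zsmul_eq_mul]
    exact congrArg Units.val h

end GraphAlgebraCompletion

end

/-! ### Injectivity -/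

theorem proposition5p4 {V : Type u} (G : SimpleGraph V) :
    (∀ u : V,
      (ExtendedGraphGroup.eta G (ExtendedGraphGroup.sigma G u) : GraphAlgebraCompletion G) =
          ((MonoidAlgebra.of ℤ (GraphGroup G) (GraphGroup.gen G u) : GraphAlgebra G) :
            GraphAlgebraCompletion G) ∧
      (ExtendedGraphGroup.eta G (ExtendedGraphGroup.tau G u) : GraphAlgebraCompletion G) =
          ((MonoidAlgebra.of ℤ (GraphGroup G) (GraphGroup.gen G u) -
              MonoidAlgebra.of ℤ (GraphGroup G) (GraphGroup.gen G u)⁻¹ : GraphAlgebra G) :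
            GraphAlgebraCompletion G)) ∧
    Function.Injective (ExtendedGraphGroup.eta G) := by
  refine ⟨fun u => ⟨?_, ?_⟩, (injective_iff_map_eq_one _).mpr fun g hg => ?_⟩
  · rw [ExtendedGraphGroup.eta, ExtendedGraphGroup.sigma, GraphProduct.lift_of,
      ExtendedGraphGroup.etaVertex_apply]
    simp [GraphAlgebraCompletion.sigma_val]
    rfl
  · rw [ExtendedGraphGroup.eta, ExtendedGraphGroup.tau, GraphProduct.lift_of,
      ExtendedGraphGroup.etaVertex_apply]
    simp [GraphAlgebraCompletion.tau_val, UniformSpace.Completion.coe_sub]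
    rfl
  · obtain ⟨L, rfl, hL1, hL⟩ := GraphProduct.exists_reduced_prod_eq g
    set w : Fin L.length → V := fun i => (L.get i).1
    have hw : G.IsReducedWord w := GraphProduct.isReducedWord_of_forall_append hL
    choose a c hc hac using fun i => GraphAlgebraCompletion.exists_completionRep_etaVertex hw
      (L.get i).1 (L.get i).2
    obtain ⟨b, hb⟩ := exists_prod_map_smul_eq a
      (fun i => 1 + c i • G.peelMatrix w (LaurentSeries ℚ) (w i)) (List.finRange L.length)
    have hprod : GraphAlgebraCompletion.completionRep hw (ExtendedGraphGroup.eta G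
        (L.map fun p => GraphProduct.of _ G p.1 p.2).prod : (GraphAlgebraCompletion G)ˣ) =
        (b : LaurentSeries ℚ) • (List.ofFn fun i => 1 + c i • G.peelMatrix w _ (w i)).prod := by
      have hmap : ∀ {N : Type u} (f : (Σ _ : V, Multiplicative ℤ × Multiplicative ℤ) → N),
          L.map f = (List.finRange L.length).map fun i => f (L.get i) := fun f =>
        List.ext_getElem (by simp) (by simp)
      rw [List.ofFn_eq_map, ← hb, ← funext hac, hmap, map_list_prod, List.map_map,
        ← Units.coeHom_apply, map_list_prod, map_list_prod, List.map_map, List.map_map]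
      congr 2
    rcases L.length.eq_zero_or_pos with h0 | hpos
    · rw [List.eq_nil_of_length_eq_zero h0, List.map_nil, List.prod_nil]
    · rw [hg, Units.val_one, map_one] at hprod
      exact absurd hprod.symm (SimpleGraph.smul_prod_one_add_smul_peelMatrix_ne_one hpos b.ne_zero
        fun i => hc i (hL1 _ (L.get_mem i)))
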